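/- Let $(W,S)$ be an irreducible Coxeter system with $W$ finite, so that its Coxeter graph (vertex set $S$, with $s\ne t$ adjacent when the order of $st$ is at least $3$) is connected and non-empty. Let $\ell$ be the length function. For $J\subseteq S$ let $\mathcal D_J=\{w\in W : \text{for all } s\in S,\ \ell(ws)<\ell(w)\Leftrightarrow s\in J\}$ be the descent class of $J$, and let $K(W)=\max_{J\subseteq S}\#\mathcal D_J$ be the Springer number of $(W,S)$. (1) Let $J\subseteq S$ and let $e$ be an edge of the Coxeter graph whose endpoints are both in $J$ or both not in $J$. Then the graph obtained by removing $e$ has exactly two connected components. Let $S_1$, $S_2$ be their vertex sets, in either order, so that $S=S_1\sqcup S_2$, and let $J'=(S_1\cap J)\cup(S_2\cap(S\setminus J))$. Then $\#\mathcal D_J<\#\mathcal D_{J'}$. (2) For every $J\subseteq S$, $K(W)=\#\mathcal D_J$ if and only if $J$ and $S\setminus J$ are both independent subsets of the Coxeter graph (that is, neither contains two adjacent vertices). (3) There are exactly two subsets $J\subseteq S$ with $K(W)=\#\mathcal D_J$, and they are complementary to each other. -/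

import Mathlib

/-- The Coxeter graph of a Coxeter matrix: the vertices are the indices of the simple reflections,
and `i`, `j` are adjacent when `i ≠ j` and `M i j ≥ 3` (the value `0`, which encodes `∞`,
also gives an edge). -/
def CoxeterMatrix.coxeterGraph {B : Type*} (M : CoxeterMatrix B) : SimpleGraph B where
  Adj i j := i ≠ j ∧ M i j ≠ 2
  symm := ⟨fun i j h => ⟨h.1.symm, by rw [M.symmetric j i]; exact h.2⟩⟩
  loopless := ⟨fun _ h => h.1 rfl⟩

/-- The descent class of `J`: the elements whose set of (right) descents is exactly `J`. -/
def CoxeterSystem.descentClass {B W : Type*} [Group W] {M : CoxeterMatrix B}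
    (cs : CoxeterSystem M W) (J : Set B) : Set W :=
  {w | ∀ i : B, cs.length (w * cs.simple i) < cs.length w ↔ i ∈ J}

/-- The Springer number: the largest cardinality of a descent class. It is meant for a finite
group, where the cardinalities are bounded by that of the group, so that the supremum in `ℕ` is
a maximum. -/
noncomputable def CoxeterSystem.springerNumber {B W : Type*} [Group W] {M : CoxeterMatrix B}
    (cs : CoxeterSystem M W) : ℕ :=
  ⨆ J : Set B, (cs.descentClass J).ncard

/-!
The sizes of descent classes are volumes. In a Euclidean realization of the finite Coxeter group `W`,
the reflecting hyperplanes cut the unit ball into `#W` congruent chambers, and the chambers in the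
orthant where exactly the simple roots with index in `J` are negative correspond to the elements
of the descent class of `J`; hence this orthant fills the fraction `#D_J / #W` of the ball
(`CoxeterSystem.EuclideanRealization.card_mul_ballVolume_orthant`). In particular `J` and its
complement have descent classes of the same size, by the symmetry `p ↦ -p`.

The Coxeter graph is a forest (`CoxeterSystem.isAcyclic_coxeterGraph`), so removing an edge
`s(x, y)` splits the simple roots into two blocks, and the roots of `x` and `y` are the only pair from
different blocks that is not orthogonal. If both or neither of `x`, `y` belong to `J`, the two signed
roots have negative inner product. Complementing `J` on one side negates the second block, which makes
this inner product positive and changes no inner product within a block or any other one between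
the blocks. That the volume of the orthant grows strictly is a case of Slepian's inequality, and
has an elementary proof here (`ballVolume_orthant_lt`): let `v` be the component of the first
root of the distinguished pair orthogonal to the rest of its block. Up to an isometry, negating the
second block amounts to applying the reflection along `v` to the conditions of this block only. The
conditions of the first block are monotone along `v` and those of the second block are antitone, so
a pair of points exchanged by the reflection has at least as many points in the new region as it
had in the old one, and strictly more on a nonempty open set.

A descent class of maximal size must therefore come from a `J` such that `J` and its complement are
independent, and a connected graph has at most one partition into two independent sets.

The geometric input is the theorem that an element sends a simple root to a positive root unless
this simple root is a right descent (`CoxeterSystem.geometricRep_single_nonneg`). It is proved for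
the geometric representation of an arbitrary Coxeter group by reduction to dihedral groups. When the
group is finite, averaging gives an invariant Euclidean norm, for which the simple roots have the
prescribed angles (`CoxeterSystem.exists_euclideanRealization`).
-/

/-! ### The geometric representation -/

section GeometricRepresentation

open Real

namespace CoxeterMatrix

variable {B : Type*} (M : CoxeterMatrix B)

/-- The linear form on the space of the geometric representation that is twice the pairing with
the `i`-th simple root for the canonical bilinear form. The junk value `π / 0 = 0` makes the
pairing `-1` when `M i j = 0`, that is, when the order is infinite, as it should be. -/
noncomputable def simpleCoroot (i : B) : (B →₀ ℝ) →ₗ[ℝ] ℝ :=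
  Finsupp.linearCombination ℝ fun j => -2 * cos (π / M i j)

@[simp]
theorem simpleCoroot_single (i j : B) (a : ℝ) :
    M.simpleCoroot i (Finsupp.single j a) = a * (-2 * cos (π / M i j)) := by
  simp [simpleCoroot]

theorem simpleCoroot_single_self (i : B) : M.simpleCoroot i (Finsupp.single i 1) = 2 := by
  simp

/-- The reflection of the geometric representation attached to `i`. -/
noncomputable def simpleReflection (i : B) : Module.End ℝ (B →₀ ℝ) :=
  Module.preReflection (Finsupp.single i 1) (M.simpleCoroot i)

theorem simpleReflection_apply (i : B) (v : B →₀ ℝ) :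
    M.simpleReflection i v = v - M.simpleCoroot i v • Finsupp.single i 1 :=
  Module.preReflection_apply _ _ _

theorem simpleReflection_single_self (i : B) :
    M.simpleReflection i (Finsupp.single i 1) = -Finsupp.single i 1 :=
  Module.preReflection_apply_self (M.simpleCoroot_single_self i)

theorem simpleReflection_single (i j : B) :
    M.simpleReflection i (Finsupp.single j 1) =
      Finsupp.single j 1 + (2 * cos (π / M i j)) • Finsupp.single i 1 := by
  rw [simpleReflection_apply, simpleCoroot_single, one_mul, neg_mul, neg_smul, sub_neg_eq_add]

theorem simpleReflection_mul_self (i : B) : M.simpleReflection i * M.simpleReflection i = 1 :=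
  LinearMap.ext fun v => Module.involutive_preReflection (M.simpleCoroot_single_self i) v

/-- The coefficients, in the two simple roots of a dihedral subgroup, of the roots that are obtained
from these two by alternating reflections. They satisfy the recurrence of the numbers
`sin (k * θ) / sin θ`, where `θ = π / m`, which degenerate to `k` when `m = 0`. -/
noncomputable def dihedralCoeff (m k : ℕ) : ℝ :=
  if m = 0 then k else sin (k * (π / m)) / sin (π / m)

@[simp]
theorem dihedralCoeff_zero (m : ℕ) : dihedralCoeff m 0 = 0 := by simp [dihedralCoeff]

theorem sin_pi_div_pos {m : ℕ} (hm : 2 ≤ m) : 0 < sin (π / m) := by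
  have h2 : (2 : ℝ) ≤ m := by exact_mod_cast hm
  apply sin_pos_of_pos_of_lt_pi (by positivity)
  rw [div_lt_iff₀ (by linarith)]
  nlinarith [pi_pos]

theorem dihedralCoeff_one {m : ℕ} (hm : m ≠ 1) : dihedralCoeff m 1 = 1 := by
  unfold dihedralCoeff
  split_ifs with h
  · simp
  · have := sin_pi_div_pos (m := m) (by omega)
    simp [this.ne']

theorem dihedralCoeff_add_two (m k : ℕ) :
    dihedralCoeff m (k + 2) = 2 * cos (π / m) * dihedralCoeff m (k + 1) - dihedralCoeff m k := by
  unfold dihedralCoeff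
  split_ifs with h
  · subst h
    push_cast
    simp
    ring
  · have h1 : (((k + 2 : ℕ) : ℝ) * (π / m)) = ((k + 1 : ℕ) : ℝ) * (π / m) + π / m := by
      push_cast; ring
    have h2 : ((k : ℝ) * (π / m)) = ((k + 1 : ℕ) : ℝ) * (π / m) - π / m := by
      push_cast; ring
    rw [h1, h2, sin_add, sin_sub]
    ring

theorem dihedralCoeff_nonneg {m k : ℕ} (h : m = 0 ∨ k ≤ m) : 0 ≤ dihedralCoeff m k := by
  unfold dihedralCoeff
  split_ifs with hm
  · positivity
  · have hk : (k : ℝ) ≤ m := by exact_mod_cast h.resolve_left hm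
    have hm0 : (0 : ℝ) < m := by positivity
    have hm1 : (1 : ℝ) ≤ m := by exact_mod_cast Nat.one_le_iff_ne_zero.mpr hm
    apply div_nonneg
    · apply sin_nonneg_of_nonneg_of_le_pi (by positivity)
      rw [mul_div_assoc', div_le_iff₀ hm0]
      nlinarith [pi_pos]
    · apply sin_nonneg_of_nonneg_of_le_pi (by positivity)
      rw [div_le_iff₀ hm0]
      nlinarith [pi_pos]

/-- The action of an alternating product of two simple reflections on the simple root whose
reflection is not the last letter, that is, not the first to act. -/
theorem prod_alternatingWord_simpleReflection_single {i j : B} (hij : i ≠ j) (k : ℕ) :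
    ((CoxeterSystem.alternatingWord i j k).map M.simpleReflection).prod (Finsupp.single i 1) =
      if Even k then
        dihedralCoeff (M i j) (k + 1) • Finsupp.single i 1 +
          dihedralCoeff (M i j) k • Finsupp.single j 1
      else
        dihedralCoeff (M i j) k • Finsupp.single i 1 +
          dihedralCoeff (M i j) (k + 1) • Finsupp.single j 1 := by
  induction k with
  | zero => simp [CoxeterSystem.alternatingWord, dihedralCoeff_one (M.off_diagonal i j hij)]
  | succ k ih =>
    rw [CoxeterSystem.alternatingWord_succ', List.map_cons, List.prod_cons, Module.End.mul_apply,
      ih]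
    by_cases hk : Even k
    · rw [if_pos hk, if_pos hk, if_neg (by simpa [Nat.even_add_one] using hk), map_add, map_smul,
        map_smul, simpleReflection_single_self, simpleReflection_single, M.symmetric j i,
        dihedralCoeff_add_two]
      module
    · rw [if_neg hk, if_neg hk, if_pos (by simpa [Nat.even_add_one] using hk), map_add, map_smul,
        map_smul, simpleReflection_single_self, simpleReflection_single, dihedralCoeff_add_two]
      module

theorem prod_alternatingWord_two_mul {G : Type*} [Monoid G] (f : B → G) (i j : B) (k : ℕ) :
    ((CoxeterSystem.alternatingWord i j (2 * k)).map f).prod = (f i * f j) ^ k := by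
  induction k with
  | zero => simp [CoxeterSystem.alternatingWord]
  | succ k ih =>
    rw [mul_add, mul_one, CoxeterSystem.alternatingWord_succ', CoxeterSystem.alternatingWord_succ',
      List.map_cons, List.map_cons, List.prod_cons, List.prod_cons, ih, pow_succ']
    simp [mul_assoc]

theorem dihedralCoeff_two_mul_self {m : ℕ} (hm : m ≠ 0) : dihedralCoeff m (2 * m) = 0 := by
  have hm0 : (m : ℝ) ≠ 0 := by exact_mod_cast hm
  rw [dihedralCoeff, if_neg hm, Nat.cast_mul, mul_assoc, mul_div_cancel₀ _ hm0]
  simp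

theorem dihedralCoeff_two_mul_self_add_one {m : ℕ} (hm : m ≠ 0) (hm1 : m ≠ 1) :
    dihedralCoeff m (2 * m + 1) = 1 := by
  have hm0 : (m : ℝ) ≠ 0 := by exact_mod_cast hm
  have := sin_pi_div_pos (m := m) (by omega)
  rw [dihedralCoeff, if_neg hm, Nat.cast_add, Nat.cast_mul, add_mul, mul_assoc,
    mul_div_cancel₀ _ hm0]
  simp [this.ne', add_comm, sin_add_two_pi]

theorem simpleReflection_mul_pow_single {i j : B} (hij : i ≠ j) (h0 : M i j ≠ 0) :
    ((M.simpleReflection i * M.simpleReflection j) ^ M i j) (Finsupp.single i 1) =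
      Finsupp.single i 1 := by
  rw [← prod_alternatingWord_two_mul, prod_alternatingWord_simpleReflection_single M hij,
    if_pos (even_two_mul _), dihedralCoeff_two_mul_self h0,
    dihedralCoeff_two_mul_self_add_one h0 (M.off_diagonal i j hij)]
  simp

/-- The simple reflections of the geometric representation satisfy the Coxeter relations. -/
theorem isLiftable_simpleReflection : M.IsLiftable M.simpleReflection := by
  intro i j
  by_cases hij : i = j
  · subst hij
    rw [M.diagonal, pow_one, simpleReflection_mul_self]
  by_cases h0 : M i j = 0
  · rw [h0, pow_zero]
  have h1 := M.simpleReflection_mul_pow_single hij h0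
  have h2 : ((M.simpleReflection i * M.simpleReflection j) ^ M i j) (Finsupp.single j 1) =
      Finsupp.single j 1 := by
    have hji := M.simpleReflection_mul_pow_single (Ne.symm hij) (by rwa [M.symmetric])
    rw [M.symmetric j i] at hji
    have hinv : (M.simpleReflection i * M.simpleReflection j) ^ M i j *
        (M.simpleReflection j * M.simpleReflection i) ^ M i j = 1 := by
      have hc : (M.simpleReflection i * M.simpleReflection j) *
          (M.simpleReflection j * M.simpleReflection i) = 1 := by
        rw [mul_assoc, ← mul_assoc (M.simpleReflection j), simpleReflection_mul_self, one_mul,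
          simpleReflection_mul_self]
      have hc' : (M.simpleReflection j * M.simpleReflection i) *
          (M.simpleReflection i * M.simpleReflection j) = 1 := by
        rw [mul_assoc, ← mul_assoc (M.simpleReflection i), simpleReflection_mul_self, one_mul,
          simpleReflection_mul_self]
      rw [← (show Commute _ _ from hc.trans hc'.symm).mul_pow, hc, one_pow]
    calc _ = ((M.simpleReflection i * M.simpleReflection j) ^ M i j)
          (((M.simpleReflection j * M.simpleReflection i) ^ M i j) (Finsupp.single j 1)) := by
            rw [hji]
      _ = _ := by rw [← Module.End.mul_apply, hinv, Module.End.one_apply]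
  -- The canonical form is nondegenerate on the plane of the two roots, so any vector is the sum
  -- of a vector of this plane and of one that both reflections fix.
  ext1 k
  ext1
  set z : B →₀ ℝ := Finsupp.single k 1
  simp only [LinearMap.comp_apply, Finsupp.lsingle_apply]
  change ((M.simpleReflection i * M.simpleReflection j) ^ M i j) z = z
  set c : ℝ := cos (π / M i j) with hc
  have hs : 0 < 1 - c ^ 2 := by
    have := sin_pi_div_pos (m := M i j) (by have := M.off_diagonal i j hij; omega)
    have := sin_sq_add_cos_sq (π / M i j)
    nlinarith
  set p := M.simpleCoroot i z / 2 with hp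
  set q := M.simpleCoroot j z / 2 with hq
  set a := (p + c * q) / (1 - c ^ 2) with ha
  set b := (q + c * p) / (1 - c ^ 2) with hb
  set v := z - a • Finsupp.single i 1 - b • Finsupp.single j 1 with hv
  have hvi : M.simpleReflection i v = v := by
    have : M.simpleCoroot i v = 0 := by
      simp only [hv, map_sub, map_smul, simpleCoroot_single, smul_eq_mul, ← hc, M.diagonal,
        Nat.cast_one, div_one, cos_pi]
      rw [show M.simpleCoroot i z = 2 * p by rw [hp]; ring, ha, hb]
      field_simp
      ring
    rw [simpleReflection_apply, this, zero_smul, sub_zero]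
  have hvj : M.simpleReflection j v = v := by
    have : M.simpleCoroot j v = 0 := by
      simp only [hv, map_sub, map_smul, simpleCoroot_single, smul_eq_mul, M.symmetric j i, ← hc,
        M.diagonal, Nat.cast_one, div_one, cos_pi]
      rw [show M.simpleCoroot j z = 2 * q by rw [hq]; ring, ha, hb]
      field_simp
      ring
    rw [simpleReflection_apply, this, zero_smul, sub_zero]
  have hpow (n : ℕ) : ((M.simpleReflection i * M.simpleReflection j) ^ n) v = v := by
    induction n with
    | zero => simp
    | succ n ih => rw [pow_succ, Module.End.mul_apply, Module.End.mul_apply, hvj, hvi, ih]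
  rw [show z = v + a • Finsupp.single i 1 + b • Finsupp.single j 1 by rw [hv]; module]
  simp only [map_add, map_smul, hpow, h1, h2]

end CoxeterMatrix

namespace CoxeterSystem

variable {B W : Type*} [Group W] {M : CoxeterMatrix B} (cs : CoxeterSystem M W)

/-- The geometric representation of a Coxeter group, on the space with basis the simple roots. -/
noncomputable def geometricRep : W →* Module.End ℝ (B →₀ ℝ) :=
  cs.lift ⟨M.simpleReflection, M.isLiftable_simpleReflection⟩

@[simp]
theorem geometricRep_simple (i : B) : cs.geometricRep (cs.simple i) = M.simpleReflection i :=
  cs.lift_apply_simple M.isLiftable_simpleReflection i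

theorem geometricRep_wordProd (l : List B) :
    cs.geometricRep (cs.wordProd l) = (l.map M.simpleReflection).prod := by
  induction l with
  | nil => simp
  | cons i l ih => rw [wordProd_cons, map_mul, ih, geometricRep_simple, List.map_cons,
      List.prod_cons]

/-- If `i` is not a right descent of `w`, then `w` is the product, with lengths adding up, of some
`v` that has neither of the right descents `i`, `j` and of an alternating word in `i`, `j`
that ends with `j` and is shorter than the braid relation. -/
theorem exists_eq_mul_alternatingWord {w : W} {i j : B} (hi : ¬ cs.IsRightDescent w i) :
    ∃ v k, w = v * cs.wordProd (alternatingWord i j k) ∧ cs.length v + k = cs.length w ∧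
      ¬ cs.IsRightDescent v i ∧ ¬ cs.IsRightDescent v j ∧ (M i j = 0 ∨ k < M i j) := by
  classical
  let P : ℕ → Prop := fun k =>
    ∃ v, w = v * cs.wordProd (alternatingWord i j k) ∧ cs.length v + k = cs.length w
  have hP0 : P 0 := ⟨w, by simp [alternatingWord], by simp⟩
  obtain ⟨v, hw, hl⟩ : P (Nat.findGreatest P (cs.length w)) :=
    Nat.findGreatest_spec (Nat.zero_le _) hP0
  set k := Nat.findGreatest P (cs.length w) with hk
  have hmax (n : ℕ) (hn : P n) : n ≤ k :=
    Nat.le_findGreatest (by obtain ⟨_, _, h⟩ := hn; omega) hn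
  have hlt : M i j = 0 ∨ k < M i j := by
    by_contra! hcon
    obtain ⟨h0, hle⟩ := hcon
    -- The last `M i j` letters can be rewritten so that `w` ends with `i`.
    apply hi
    have hsplit (n : ℕ) : ∃ u : List B, u.length = n ∧
        alternatingWord i j (M i j + n) = u ++ alternatingWord i j (M i j) := by
      induction n with
      | zero => exact ⟨[], by simp⟩
      | succ n ih =>
        obtain ⟨u, hu, h⟩ := ih
        rw [← add_assoc, alternatingWord_succ', h]
        exact ⟨_ :: u, by simp [hu], rfl⟩
    obtain ⟨u, hu, h⟩ := hsplit (k - M i j)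
    rw [Nat.add_sub_cancel' hle] at h
    have hbraid := cs.wordProd_braidWord_eq i j
    rw [braidWord, braidWord, M.symmetric j i] at hbraid
    obtain ⟨m, hm⟩ := Nat.exists_eq_succ_of_ne_zero h0
    have hws : w * cs.simple i = v * cs.wordProd u * cs.wordProd (alternatingWord i j m) := by
      rw [hw, h, wordProd_append, hbraid, hm, Nat.succ_eq_add_one, alternatingWord_succ,
        wordProd_concat]
      simp [mul_assoc]
    have h1 := cs.length_mul_le (v * cs.wordProd u) (cs.wordProd (alternatingWord i j m))
    have h2 := cs.length_mul_le v (cs.wordProd u)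
    have h3 := cs.length_wordProd_le u
    have h4 := cs.length_wordProd_le (alternatingWord i j m)
    rw [length_alternatingWord] at h4
    rw [IsRightDescent, hws]
    omega
  -- The letter that would prolong the alternating word is not a descent, by maximality.
  have hnext : ¬ cs.IsRightDescent v (if Even k then j else i) := by
    intro hd
    rw [isRightDescent_iff] at hd
    have : P (k + 1) := by
      refine ⟨v * cs.simple (if Even k then j else i), ?_, by omega⟩
      rw [alternatingWord_succ', wordProd_cons, ← mul_assoc, simple_mul_simple_cancel_right]
      exact hw
    have := hmax _ this
    omega
  -- The first letter of the alternating word is not a descent, because lengths add up.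
  have hfirst : ¬ cs.IsRightDescent v (if Even k then i else j) := by
    by_cases hk0 : k = 0
    · rw [hk0] at hw ⊢
      simp only [alternatingWord, wordProd_nil, mul_one] at hw
      simpa [← hw] using hi
    · obtain ⟨n, hn⟩ := Nat.exists_eq_succ_of_ne_zero hk0
      intro hd
      rw [isRightDescent_iff] at hd
      have hlet : (if Even k then i else j) = if Even n then j else i := by
        rw [hn, Nat.succ_eq_add_one]
        by_cases he : Even n <;> simp [Nat.even_add_one, he]
      rw [hn, Nat.succ_eq_add_one, alternatingWord_succ', wordProd_cons, ← mul_assoc, ← hlet] at hw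
      have h1 := cs.length_mul_le (v * cs.simple (if Even k then i else j))
        (cs.wordProd (alternatingWord i j n))
      have h4 := cs.length_wordProd_le (alternatingWord i j n)
      rw [length_alternatingWord] at h4
      rw [← hw] at h1
      omega
  by_cases he : Even k
  · rw [if_pos he] at hnext hfirst
    exact ⟨v, k, hw, hl, hfirst, hnext, hlt⟩
  · rw [if_neg he] at hnext hfirst
    exact ⟨v, k, hw, hl, hnext, hfirst, hlt⟩

/-- An element sends a simple root to a positive root unless that root is a right descent. -/
theorem geometricRep_single_nonneg (w : W) (i : B) (hi : ¬ cs.IsRightDescent w i) :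
    0 ≤ cs.geometricRep w (Finsupp.single i 1) := by
  induction hn : cs.length w using Nat.strong_induction_on generalizing w i with
  | _ n ih =>
    by_cases hw1 : w = 1
    · simp [hw1]
    obtain ⟨j, hj⟩ := cs.exists_rightDescent_of_ne_one hw1
    have hij : i ≠ j := by rintro rfl; exact hi hj
    obtain ⟨v, k, hw, hl, hvi, hvj, hk⟩ := cs.exists_eq_mul_alternatingWord (j := j) hi
    have hk0 : k ≠ 0 := by
      rintro rfl
      simp only [alternatingWord, wordProd_nil, mul_one] at hw
      exact hvj (hw ▸ hj)
    have pi := ih _ (by omega) v i hvi rfl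
    have pj := ih _ (by omega) v j hvj rfl
    have c1 : 0 ≤ CoxeterMatrix.dihedralCoeff (M i j) k :=
      CoxeterMatrix.dihedralCoeff_nonneg (by omega)
    have c2 : 0 ≤ CoxeterMatrix.dihedralCoeff (M i j) (k + 1) :=
      CoxeterMatrix.dihedralCoeff_nonneg (by omega)
    rw [hw, map_mul, geometricRep_wordProd, Module.End.mul_apply,
      M.prod_alternatingWord_simpleReflection_single hij]
    split_ifs
    · rw [map_add, map_smul, map_smul]
      exact add_nonneg (smul_nonneg c2 pi) (smul_nonneg c1 pj)
    · rw [map_add, map_smul, map_smul]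
      exact add_nonneg (smul_nonneg c1 pi) (smul_nonneg c2 pj)

end CoxeterSystem

end GeometricRepresentation

/-! ### Realization in a Euclidean space -/

section EuclideanRealization

open Real
open scoped RealInnerProductSpace

/-- A linear representation of a finite group on a real space of finite dimension is isometric for
some Euclidean norm. -/
theorem exists_linearEquiv_euclideanSpace_norm_eq {B W : Type*} [Group W] [Finite W] [Finite B]
    (ρ : W →* Module.End ℝ (B →₀ ℝ)) :
    ∃ (n : ℕ) (T : (B →₀ ℝ) ≃ₗ[ℝ] EuclideanSpace ℝ (Fin n)),
      ∀ w v, ‖T (ρ w v)‖ = ‖T v‖ := by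
  classical
  have := Fintype.ofFinite W
  have := Fintype.ofFinite B
  -- The invariant norm is the sum over the group of the translates of the standard one.
  let Φ : (B →₀ ℝ) →ₗ[ℝ] EuclideanSpace ℝ (W × B) :=
    { toFun := fun v => WithLp.toLp 2 fun x => ρ x.1 v x.2
      map_add' := fun v v' => by ext x; simp
      map_smul' := fun a v => by ext x; simp }
  have hΦ (x : W × B) (v : B →₀ ℝ) : Φ v x = ρ x.1 v x.2 := rfl
  have hinj : Function.Injective Φ := by
    intro v v' h
    ext b
    have := congrArg (fun f : EuclideanSpace ℝ (W × B) => f (1, b)) h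
    simpa [hΦ] using this
  have hnorm (w : W) (v : B →₀ ℝ) : ‖Φ (ρ w v)‖ = ‖Φ v‖ := by
    rw [EuclideanSpace.norm_eq, EuclideanSpace.norm_eq]
    congr 1
    refine Fintype.sum_equiv ((Equiv.mulRight w).prodCongr (Equiv.refl B)) _ _ fun x => ?_
    simp [hΦ]
  let e := LinearEquiv.ofInjective Φ hinj
  let b := stdOrthonormalBasis ℝ (LinearMap.range Φ)
  refine ⟨_, e.trans b.repr.toLinearEquiv, fun w v => ?_⟩
  simp only [LinearEquiv.trans_apply, LinearIsometryEquiv.coe_toLinearEquiv,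
    LinearIsometryEquiv.norm_map]
  exact hnorm w v

namespace CoxeterSystem

variable {B W : Type*} [Group W] {M : CoxeterMatrix B} (cs : CoxeterSystem M W)

theorem simple_injective : Function.Injective cs.simple := by
  intro i j hij
  by_contra hne
  have h := congrArg (fun w => cs.geometricRep w (Finsupp.single i 1) i) hij
  simp only [geometricRep_simple, M.simpleReflection_single_self, M.simpleReflection_single] at h
  simp [Ne.symm hne] at h
  linarith

/-- A realization of a Coxeter group as a group of isometries of a Euclidean space that is generated
by the reflections in the hyperplanes orthogonal to linearly independent unit vectors, the
simple roots. The angles between these are prescribed by the Coxeter matrix (with `π / 0 = 0`), and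
the last field says that an element sends a simple root to one that is positive on the
fundamental chamber, unless this simple root is a right descent. -/
structure EuclideanRealization (E : Type*) [NormedAddCommGroup E] [InnerProductSpace ℝ E] where
  /-- The action by isometries. -/
  toHom : W →* (E ≃ₗᵢ[ℝ] E)
  /-- The simple roots. -/
  root : B → E
  linearIndependent_root : LinearIndependent ℝ root
  norm_root : ∀ i, ‖root i‖ = 1
  inner_root : ∀ i j, i ≠ j → ⟪root i, root j⟫ = -cos (π / M i j)
  toHom_simple : ∀ i p, toHom (cs.simple i) p = p - (2 * ⟪root i, p⟫) • root i
  inner_pos : ∀ w i p, ¬ cs.IsRightDescent w i → (∀ j, 0 < ⟪root j, p⟫) →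
    0 < ⟪toHom w (root i), p⟫

/-- A finite Coxeter group has a Euclidean realization: the geometric representation, with an
invariant inner product. -/
theorem exists_euclideanRealization [Finite W] :
    ∃ n : ℕ, Nonempty (cs.EuclideanRealization (EuclideanSpace ℝ (Fin n))) := by
  have : Finite B := Finite.of_injective _ cs.simple_injective
  obtain ⟨n, T, hT⟩ := exists_linearEquiv_euclideanSpace_norm_eq cs.geometricRep
  refine ⟨n, ⟨?_⟩⟩
  have hmul (w w' : W) (v : B →₀ ℝ) :
      cs.geometricRep w (cs.geometricRep w' v) = cs.geometricRep (w * w') v := by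
    rw [map_mul, Module.End.mul_apply]
  have hinv (w : W) (v : B →₀ ℝ) : cs.geometricRep w⁻¹ (cs.geometricRep w v) = v := by
    rw [hmul, inv_mul_cancel, map_one, Module.End.one_apply]
  have hinv' (w : W) (v : B →₀ ℝ) : cs.geometricRep w (cs.geometricRep w⁻¹ v) = v := by
    rw [hmul, mul_inv_cancel, map_one, Module.End.one_apply]
  let f : W →* (EuclideanSpace ℝ (Fin n) ≃ₗᵢ[ℝ] EuclideanSpace ℝ (Fin n)) :=
    { toFun := fun w =>
        { toFun := fun p => T (cs.geometricRep w (T.symm p))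
          invFun := fun p => T (cs.geometricRep w⁻¹ (T.symm p))
          map_add' := fun p q => by simp
          map_smul' := fun a p => by simp
          left_inv := fun p => by simp [hinv]
          right_inv := fun p => by simp [hinv']
          norm_map' := fun p => by
            simp only [LinearEquiv.coe_mk, LinearMap.coe_mk, AddHom.coe_mk]
            rw [hT, T.apply_symm_apply] }
      map_one' := by ext1 p; simp
      map_mul' := fun w w' => by ext1 p; simp }
  have hf (w : W) (v : B →₀ ℝ) : f w (T v) = T (cs.geometricRep w v) := by
    change T (cs.geometricRep w (T.symm (T v))) = _
    rw [T.symm_apply_apply]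
  let a (i : B) : EuclideanSpace ℝ (Fin n) := T (Finsupp.single i 1)
  have ha0 (i : B) : a i ≠ 0 := by simp [a]
  have hfa (i : B) : f (cs.simple i) (a i) = -a i := by
    rw [hf, geometricRep_simple, M.simpleReflection_single_self, map_neg]
  have hfT (i : B) (v : B →₀ ℝ) :
      f (cs.simple i) (T v) = T v - M.simpleCoroot i v • a i := by
    rw [hf, geometricRep_simple, M.simpleReflection_apply, map_sub, map_smul]
  -- As the reflections are isometries, their linear forms are given by the inner product.
  have hcoroot (i : B) (v : B →₀ ℝ) : M.simpleCoroot i v * ‖a i‖ ^ 2 = 2 * ⟪a i, T v⟫ := by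
    have h := (f (cs.simple i)).inner_map_map (a i) (T v)
    rw [hfa, hfT, inner_neg_left, inner_sub_right, inner_smul_right,
      real_inner_self_eq_norm_sq] at h
    linarith
  have hinner (i j : B) : ⟪a i, a j⟫ = -cos (π / M i j) * ‖a i‖ ^ 2 := by
    have h := hcoroot i (Finsupp.single j 1)
    rw [M.simpleCoroot_single] at h
    change _ = 2 * ⟪a i, a j⟫ at h
    linarith
  have hpos (i : B) : 0 < ‖a i‖ := norm_pos_iff.mpr (ha0 i)
  refine
    { toHom := f
      root := fun i => ‖a i‖⁻¹ • a i
      linearIndependent_root := ?_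
      norm_root := fun i => ?_
      inner_root := fun i j hij => ?_
      toHom_simple := fun i p => ?_
      inner_pos := fun w i p hi hp => ?_ }
  · have h1 : LinearIndependent ℝ a := by
      have h := (Finsupp.basisSingleOne (R := ℝ) (ι := B)).linearIndependent.map' T.toLinearMap T.ker
      rwa [show T.toLinearMap ∘ Finsupp.basisSingleOne = a from
        funext fun i => by simp [a]] at h
    exact h1.units_smul fun i => Units.mk0 ‖a i‖⁻¹ (inv_ne_zero (hpos i).ne')
  · rw [norm_smul, norm_inv, norm_norm, inv_mul_cancel₀ (hpos i).ne']
  · have h1 := hinner i j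
    have h2 := hinner j i
    rw [real_inner_comm, h1, M.symmetric j i] at h2
    rw [inner_smul_left, inner_smul_right, h1]
    simp only [conj_trivial]
    by_cases hc : cos (π / M i j) = 0
    · simp [hc]
    · have h3 : ‖a i‖ ^ 2 = ‖a j‖ ^ 2 := mul_left_cancel₀ (neg_ne_zero.mpr hc) h2
      have h4 : ‖a i‖ = ‖a j‖ := (pow_left_inj₀ (hpos i).le (hpos j).le two_ne_zero).mp h3
      have := (hpos j).ne'
      rw [h4]
      field_simp
  · obtain ⟨v, rfl⟩ := T.surjective p
    rw [hfT, inner_smul_left, smul_smul]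
    have h := hcoroot i v
    have := (hpos i).ne'
    congr 2
    simp only [conj_trivial]
    field_simp
    linarith
  · have h1 := cs.geometricRep_single_nonneg w i hi
    set u := cs.geometricRep w (Finsupp.single i 1) with hu
    have hu0 : u ≠ 0 := by
      intro h0
      have := hinv w (Finsupp.single i 1)
      rw [← hu, h0, map_zero] at this
      exact ha0 i (by simp [a, ← this])
    have hp' (j : B) : 0 < ⟪a j, p⟫ := by
      have := hp j
      rw [inner_smul_left, conj_trivial] at this
      exact (mul_pos_iff_of_pos_left (inv_pos.mpr (hpos j))).mp this
    rw [map_smul, inner_smul_left, conj_trivial]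
    refine mul_pos (inv_pos.mpr (hpos i)) ?_
    rw [show f w (a i) = T u from hf w _]
    have hTu : T u = u.sum fun j c => c • a j := by
      conv_lhs => rw [← u.sum_single]
      rw [Finsupp.sum, map_sum, Finsupp.sum]
      refine Finset.sum_congr rfl fun j _ => ?_
      rw [← map_smul, Finsupp.smul_single_one]
    rw [hTu, Finsupp.sum, sum_inner]
    refine Finset.sum_pos (fun j hj => ?_) (Finsupp.support_nonempty_iff.mpr hu0)
    rw [inner_smul_left, conj_trivial]
    exact mul_pos (lt_of_le_of_ne (h1 j) (Ne.symm (Finsupp.mem_support_iff.mp hj))) (hp' j)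

end CoxeterSystem

end EuclideanRealization

/-! ### Comparison of orthants -/

section Orthants

open MeasureTheory Filter Topology
open scoped RealInnerProductSpace

variable {E : Type*} [NormedAddCommGroup E] [InnerProductSpace ℝ E]

theorem inner_reflection_comm (K : Submodule ℝ E) [K.HasOrthogonalProjection] (p q : E) :
    ⟪p, K.reflection q⟫ = ⟪K.reflection p, q⟫ := by
  rw [← K.reflection.inner_map_map, K.reflection_reflection]

theorem inner_reflection_singleton_orthogonal (v p q : E) :
    ⟪q, (ℝ ∙ v)ᗮ.reflection p⟫ = ⟪q, p⟫ - 2 * (⟪v, p⟫ / ‖v‖ ^ 2) * ⟪q, v⟫ := by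
  rw [Submodule.reflection_orthogonal_apply, Submodule.reflection_singleton_apply]
  simp only [inner_neg_right, inner_sub_right, inner_smul_right, two_smul, inner_add_right]
  simp
  ring

/-- Linearly independent vectors have arbitrary inner products with a suitable vector. -/
theorem LinearIndependent.exists_inner_eq [FiniteDimensional ℝ E] {B : Type*} {b : B → E}
    (hb : LinearIndependent ℝ b) (f : B → ℝ) : ∃ p : E, ∀ i, ⟪b i, p⟫ = f i := by
  obtain ⟨φ, hφ⟩ : ∃ φ : E →ₗ[ℝ] ℝ, ∀ i, φ (b i) = f i := by
    obtain ⟨g, hg⟩ := LinearMap.exists_extend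
      ((Finsupp.linearCombination ℝ f).comp hb.repr)
    refine ⟨g, fun i => ?_⟩
    have := LinearMap.congr_fun hg ⟨b i, Submodule.subset_span ⟨i, rfl⟩⟩
    rw [LinearMap.comp_apply, LinearMap.comp_apply, hb.repr_eq_single i _ rfl] at this
    simpa using this
  refine ⟨(InnerProductSpace.toDual ℝ E).symm φ.toContinuousLinearMap, fun i => ?_⟩
  rw [real_inner_comm, InnerProductSpace.toDual_symm_apply]
  exact hφ i

variable [FiniteDimensional ℝ E] [MeasurableSpace E] [BorelSpace E]

/-- The restriction of the volume to the unit ball, as a finite measure that every linear isometry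
preserves. -/
noncomputable def ballVolume (E : Type*) [NormedAddCommGroup E] [InnerProductSpace ℝ E]
    [FiniteDimensional ℝ E] [MeasurableSpace E] [BorelSpace E] : Measure E :=
  volume.restrict (Metric.ball 0 1)

instance : IsFiniteMeasure (ballVolume E) :=
  ⟨by simpa [ballVolume] using measure_ball_lt_top⟩

theorem ballVolume_univ_pos : 0 < ballVolume E Set.univ := by
  simpa [ballVolume] using Metric.measure_ball_pos volume (0 : E) one_pos

theorem measurePreserving_ballVolume (U : E ≃ₗᵢ[ℝ] E) :
    MeasurePreserving U (ballVolume E) (ballVolume E) := by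
  have h := U.measurePreserving.restrict_preimage (s := Metric.ball 0 1) measurableSet_ball
  rwa [show U ⁻¹' Metric.ball 0 1 = Metric.ball 0 1 by ext p; simp] at h

theorem ballVolume_preimage (U : E ≃ₗᵢ[ℝ] E) (s : Set E) :
    ballVolume E (U ⁻¹' s) = ballVolume E s :=
  (measurePreserving_ballVolume U).measure_preimage_equiv (f := U.toMeasurableEquiv) s

theorem ballVolume_pos_of_isOpen {s : Set E} (hs : IsOpen s) {p : E}
    (hp : ∀ t : ℝ, 0 < t → t • p ∈ s) : 0 < ballVolume E s := by
  rw [ballVolume, Measure.restrict_apply hs.measurableSet]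
  refine (hs.inter Metric.isOpen_ball).measure_pos volume
    ⟨(‖p‖ + 1)⁻¹ • p, hp _ (by positivity), ?_⟩
  rw [mem_ball_zero_iff, norm_smul, norm_inv, Real.norm_of_nonneg (by positivity : 0 ≤ ‖p‖ + 1),
    inv_mul_lt_iff₀ (by positivity)]
  linarith

theorem ballVolume_setOf_inner_eq_zero {v : E} (hv : v ≠ 0) :
    ballVolume E {p | ⟪v, p⟫ = 0} = 0 := by
  refine Measure.absolutelyContinuous_of_le Measure.restrict_le_self ?_
  have h := Measure.addHaar_submodule (volume : Measure E) (LinearMap.ker (innerₛₗ ℝ v)) (by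
    intro h
    have : v ∈ LinearMap.ker (innerₛₗ ℝ v) := h ▸ Submodule.mem_top
    exact hv (by simpa using this))
  convert h using 2
  ext p
  simp

/-- An orthant cut out by linearly independent vectors, split in two blocks such that exactly one
pair of vectors from different blocks is not orthogonal, with negative inner product, becomes larger
when the vectors of the second block are negated. This is a case of Slepian's inequality. -/
theorem ballVolume_orthant_lt {B : Type*} [Finite B] {b : B → E} (hb : LinearIndependent ℝ b)
    (S : Set B) {x y : B} (hx : x ∈ S) (hy : y ∉ S) (hxy : ⟪b x, b y⟫ < 0)
    (horth : ∀ i ∈ S, ∀ j ∉ S, ¬(i = x ∧ j = y) → ⟪b i, b j⟫ = 0) :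
    ballVolume E {p | (∀ i ∈ S, 0 < ⟪b i, p⟫) ∧ ∀ i ∉ S, 0 < ⟪b i, p⟫} <
      ballVolume E {p | (∀ i ∈ S, 0 < ⟪b i, p⟫) ∧ ∀ i ∉ S, ⟪b i, p⟫ < 0} := by
  classical
  set K : Submodule ℝ E := Submodule.span ℝ (b '' (S \ {x})) with hK
  have hbK {i : B} (hi : i ∈ S) (hix : i ≠ x) : b i ∈ K :=
    Submodule.subset_span ⟨i, ⟨hi, hix⟩, rfl⟩
  -- The component of `b x` orthogonal to the rest of the first block.
  set π : E := K.starProjection (b x) with hπ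
  have hπK : π ∈ K := K.starProjection_apply_mem (b x)
  set v : E := b x - π with hv
  have hvK : v ∈ Kᗮ := K.sub_starProjection_mem_orthogonal (b x)
  have hv0 : v ≠ 0 := by
    intro h0
    rw [hv, sub_eq_zero] at h0
    exact hb.notMem_span_image (s := S \ {x}) (x := x) (by simp) (h0 ▸ hπK)
  have hn : 0 < ‖v‖ ^ 2 := by positivity
  have hKorth {q : E} (hq : q ∈ K) {j : B} (hj : j ∉ S) : ⟪q, b j⟫ = 0 := by
    have : K ≤ (ℝ ∙ b j)ᗮ := by
      rw [hK, Submodule.span_le]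
      rintro _ ⟨i, ⟨hi, hix⟩, rfl⟩
      rw [SetLike.mem_coe, Submodule.mem_orthogonal_singleton_iff_inner_left]
      exact horth i hi j hj fun h => hix h.1
    exact (Submodule.mem_orthogonal_singleton_iff_inner_left).mp (this hq)
  have hvS {i : B} (hi : i ∈ S) (hix : i ≠ x) : ⟪b i, v⟫ = 0 :=
    Submodule.inner_right_of_mem_orthogonal (hbK hi hix) hvK
  have hvx : ⟪b x, v⟫ = ‖v‖ ^ 2 := by
    rw [show b x = v + π by rw [hv]; abel, inner_add_left, real_inner_self_eq_norm_sq,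
      Submodule.inner_right_of_mem_orthogonal hπK hvK, add_zero]
  have hvj {j : B} (hj : j ∉ S) : ⟪b j, v⟫ = ⟪b x, b j⟫ := by
    rw [real_inner_comm, hv, inner_sub_left, hKorth hπK hj, sub_zero]
  have hvy : ⟪b y, v⟫ < 0 := by rw [hvj hy]; exact hxy
  have hvS' {j : B} (hj : j ∉ S) (hjy : j ≠ y) : ⟪b j, v⟫ = 0 := by
    rw [hvj hj]; exact horth x hx j hj fun h => hjy h.2
  -- `r` changes the sign of the component along `v`, and `n` that of the components orthogonal to
  -- the first block.
  set r := (ℝ ∙ v)ᗮ.reflection with hr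
  set n := (Submodule.span ℝ (b '' S)).reflection with hndef
  have hrS {i : B} (hi : i ∈ S) (hix : i ≠ x) (p : E) : ⟪b i, r p⟫ = ⟪b i, p⟫ := by
    rw [hr, inner_reflection_singleton_orthogonal, hvS hi hix]; ring
  have hrx (p : E) : ⟪b x, r p⟫ = ⟪b x, p⟫ - 2 * ⟪v, p⟫ := by
    rw [hr, inner_reflection_singleton_orthogonal, hvx]; field_simp
  have hrS' {j : B} (hj : j ∉ S) (hjy : j ≠ y) (p : E) : ⟪b j, r p⟫ = ⟪b j, p⟫ := by
    rw [hr, inner_reflection_singleton_orthogonal, hvS' hj hjy]; ring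
  have hry (p : E) : ⟪b y, r p⟫ = ⟪b y, p⟫ + 2 * (⟪v, p⟫ / ‖v‖ ^ 2) * -⟪b y, v⟫ := by
    rw [hr, inner_reflection_singleton_orthogonal]; ring
  have hrr (p : E) : r (r p) = p := Submodule.reflection_reflection _ p
  have hnS {i : B} (hi : i ∈ S) (p : E) : ⟪b i, n p⟫ = ⟪b i, p⟫ := by
    rw [hndef, inner_reflection_comm,
      Submodule.reflection_mem_subspace_eq_self (Submodule.subset_span (Set.mem_image_of_mem b hi))]
  have hnr {j : B} (hj : j ∉ S) (p : E) : ⟪b j, n p⟫ = -⟪b j, r p⟫ := by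
    have hmem : b j - (⟪v, b j⟫ / ‖v‖ ^ 2) • v ∈ (Submodule.span ℝ (b '' S))ᗮ := by
      rw [Submodule.mem_orthogonal]
      intro u hu
      induction hu using Submodule.span_induction with
      | mem u hu =>
        obtain ⟨i, hi, rfl⟩ := hu
        rw [inner_sub_right, inner_smul_right]
        by_cases hix : i = x
        · subst hix
          rw [hvx, div_mul_cancel₀ _ hn.ne', ← hvj hj, real_inner_comm v (b j), sub_self]
        · rw [hvS hi hix, horth i hi j hj fun h => hix h.1]; ring
      | zero => simp
      | add u u' _ _ hu hu' => rw [inner_add_left, hu, hu', add_zero]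
      | smul a u _ hu => rw [inner_smul_left, hu, mul_zero]
    have hvmem : v ∈ Submodule.span ℝ (b '' S) :=
      Submodule.sub_mem _ (Submodule.subset_span ⟨x, hx, rfl⟩)
        (Submodule.span_mono (Set.image_mono Set.sdiff_subset) hπK)
    have h1 := Submodule.reflection_mem_subspace_orthogonalComplement_eq_neg hmem
    have h2 := Submodule.reflection_mem_subspace_eq_self hvmem
    rw [map_sub, map_smul, ← hndef] at h1
    rw [← hndef] at h2
    rw [h2] at h1
    have h3 : n (b j) = -b j + (2 * (⟪v, b j⟫ / ‖v‖ ^ 2)) • v := by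
      rw [sub_eq_iff_eq_add] at h1
      rw [h1]
      module
    rw [hndef, inner_reflection_comm, ← hndef, h3, hr, inner_reflection_singleton_orthogonal,
      inner_add_left, inner_neg_left, inner_smul_left, conj_trivial, real_inner_comm v (b j)]
    ring
  clear_value r n
  set A : Set E := {p | ∀ i ∈ S, 0 < ⟪b i, p⟫} with hA
  set G : Set E := {p | ∀ i ∉ S, 0 < ⟪b i, p⟫} with hG
  have hmA : MeasurableSet A := by
    rw [hA, Set.ofPred_forall]
    refine MeasurableSet.iInter fun i => ?_
    by_cases hi : i ∈ S
    · simpa [hi] using measurableSet_lt (by fun_prop) (by fun_prop)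
    · simp [hi]
  have hmG : MeasurableSet G := by
    rw [hG, Set.ofPred_forall]
    refine MeasurableSet.iInter fun i => ?_
    by_cases hi : i ∈ S
    · simp [hi]
    · simpa [hi] using measurableSet_lt (by fun_prop) (by fun_prop)
  have hmr : Measurable r := r.continuous.measurable
  have hmrA : MeasurableSet (r ⁻¹' A) := hmr hmA
  have hmrG : MeasurableSet (r ⁻¹' G) := hmr hmG
  -- Negating the second block amounts to applying `r` to its conditions only.
  have hneg : ballVolume E {p | (∀ i ∈ S, 0 < ⟪b i, p⟫) ∧ ∀ i ∉ S, ⟪b i, p⟫ < 0} =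
      ballVolume E (A ∩ r ⁻¹' G) := by
    rw [← ballVolume_preimage n]
    congr 1
    ext p
    simp only [Set.mem_preimage, Set.mem_ofPred_eq, Set.mem_inter_iff, hA, hG]
    refine and_congr (forall₂_congr fun i hi => by rw [hnS hi])
      (forall₂_congr fun i hi => by rw [hnr hi, neg_lt_zero])
  rw [hneg]
  change ballVolume E (A ∩ G) < _
  -- The first block is monotone along `v`, the second one antitone.
  have hmonoA {p : E} (hp : 0 ≤ ⟪v, p⟫) (h : r p ∈ A) : p ∈ A := by
    intro i hi
    have := h i hi
    by_cases hix : i = x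
    · subst hix; rw [hrx] at this; linarith
    · rwa [hrS hi hix] at this
  have hmonoG {p : E} (hp : 0 ≤ ⟪v, p⟫) (h : p ∈ G) : r p ∈ G := by
    intro i hi
    have := h i hi
    by_cases hiy : i = y
    · subst hiy
      rw [hry]
      have : 0 ≤ 2 * (⟪v, p⟫ / ‖v‖ ^ 2) * -⟪b i, v⟫ :=
        mul_nonneg (by positivity) (by linarith)
      linarith
    · rwa [hrS' hi hiy]
  have hvr (p : E) : ⟪v, r p⟫ = -⟪v, p⟫ := by
    rw [hr, inner_reflection_singleton_orthogonal, real_inner_self_eq_norm_sq]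
    field_simp
    ring
  have hsub : r ⁻¹' ((A ∩ G) \ r ⁻¹' G) ∪ ((A ∩ r ⁻¹' G) \ G) \ r ⁻¹' A ⊆
      (A ∩ r ⁻¹' G) \ G := by
    apply Set.union_subset _ Set.sdiff_subset
    rintro p ⟨⟨hpA, hpG⟩, hpG'⟩
    simp only [Set.mem_preimage, hrr] at hpG'
    have hp : 0 ≤ ⟪v, p⟫ := by
      by_contra! hlt
      have := hmonoG (p := r p) (by rw [hvr]; linarith) hpG
      rw [hrr] at this
      exact hpG' this
    exact ⟨⟨hmonoA hp hpA, hpG⟩, hpG'⟩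
  have hdisj : Disjoint (r ⁻¹' ((A ∩ G) \ r ⁻¹' G)) (((A ∩ r ⁻¹' G) \ G) \ r ⁻¹' A) := by
    rw [Set.disjoint_left]
    exact fun p hp hp' => hp'.2 hp.1.1
  -- The strict inequality comes from an open set of points that only the negated orthant has.
  have hpos : 0 < ballVolume E (((A ∩ r ⁻¹' G) \ G) \ r ⁻¹' A) := by
    let O : Set E := {p | (∀ i, 0 < (if i = y then -1 else 1) * ⟪b i, p⟫) ∧
      (∀ i, 0 < (if i = x then -1 else 1) * ⟪b i, r p⟫)}
    have hO : IsOpen O := by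
      simp only [O, Set.ofPred_and, Set.ofPred_forall]
      refine IsOpen.inter (isOpen_iInter_of_finite fun i => ?_)
        (isOpen_iInter_of_finite fun i => ?_)
      · exact isOpen_lt (by fun_prop) (by fun_prop)
      · have := r.continuous
        exact isOpen_lt (by fun_prop) (by fun_prop)
    have hxy' : x ≠ y := fun h => hy (h ▸ hx)
    have hOsub : O ⊆ ((A ∩ r ⁻¹' G) \ G) \ r ⁻¹' A := by
      rintro p ⟨h1, h2⟩
      refine ⟨⟨⟨fun i hi => ?_, fun i hi => ?_⟩, fun h => ?_⟩, fun h => ?_⟩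
      · have := h1 i
        rwa [if_neg fun h : i = y => hy (h ▸ hi), one_mul] at this
      · have := h2 i
        rwa [if_neg fun h : i = x => hi (h ▸ hx), one_mul] at this
      · have h3 := h1 y
        have h4 := h y hy
        rw [if_pos rfl] at h3
        linarith
      · have h3 := h2 x
        have h4 : 0 < ⟪b x, r p⟫ := h x hx
        rw [if_pos rfl] at h3
        linarith
    obtain ⟨p₁, hp₁⟩ := hb.exists_inner_eq fun i => if i = x then (1 : ℝ) else 0
    obtain ⟨p₂, hp₂⟩ := hb.exists_inner_eq fun i => if i = y then (-1 : ℝ) else 1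
    have hvp₁ : ⟪v, p₁⟫ = 1 := by
      have : ⟪π, p₁⟫ = 0 := by
        have hle : K ≤ (ℝ ∙ p₁)ᗮ := by
          rw [hK, Submodule.span_le]
          rintro _ ⟨i, ⟨hi, hix⟩, rfl⟩
          rw [SetLike.mem_coe, Submodule.mem_orthogonal_singleton_iff_inner_left, hp₁]
          exact if_neg hix
        exact (Submodule.mem_orthogonal_singleton_iff_inner_left).mp (hle hπK)
      rw [hv, inner_sub_left, this, hp₁, if_pos rfl, sub_zero]
    set c := ⟪v, p₂⟫ with hc
    set d := -⟪b y, v⟫ / ‖v‖ ^ 2 with hd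
    have hd0 : 0 < d := div_pos (by linarith) hn
    obtain ⟨t, ht0, ht1, ht2⟩ : ∃ t : ℝ, 0 < t ∧ 1 + t - 2 * (1 + t * c) < 0 ∧
        0 < -t + 2 * (1 + t * c) * d := by
      have e1 : ∀ᶠ t in 𝓝 (0 : ℝ), 1 + t - 2 * (1 + t * c) < 0 :=
        ContinuousAt.eventually_lt (by fun_prop) (by fun_prop) (by norm_num)
      have e2 : ∀ᶠ t in 𝓝 (0 : ℝ), 0 < -t + 2 * (1 + t * c) * d :=
        ContinuousAt.eventually_lt (by fun_prop) (by fun_prop) (by simpa using hd0)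
      have e3 : ∀ᶠ t in 𝓝[>] (0 : ℝ), 0 < t := self_mem_nhdsWithin
      exact (e3.and ((e1.filter_mono nhdsWithin_le_nhds).and
        (e2.filter_mono nhdsWithin_le_nhds))).exists
    have hvp : ⟪v, p₁ + t • p₂⟫ = 1 + t * c := by
      rw [inner_add_right, inner_smul_right, hvp₁]
    have hbp (i : B) : ⟪b i, p₁ + t • p₂⟫ = ⟪b i, p₁⟫ + t * ⟪b i, p₂⟫ := by
      rw [inner_add_right, inner_smul_right]
    have hmem : p₁ + t • p₂ ∈ O := by
      refine ⟨fun i => ?_, fun i => ?_⟩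
      · rw [hbp, hp₁, hp₂]
        by_cases hix : i = x
        · subst hix; simp [hxy']; linarith
        · by_cases hiy : i = y
          · subst hiy; simp [hix, ht0]
          · simp [hix, hiy, ht0]
      · by_cases hix : i = x
        · subst hix
          rw [hrx, hvp, hbp, hp₁, hp₂]
          simp [hxy']
          linarith
        · by_cases hiy : i = y
          · subst hiy
            rw [hry, hvp, hbp, hp₁, hp₂]
            simp only [hix, if_false, if_true]
            convert ht2 using 1
            rw [hd]
            ring
          · have : ⟪b i, r (p₁ + t • p₂)⟫ = ⟪b i, p₁ + t • p₂⟫ := by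
              by_cases hi : i ∈ S
              · exact hrS hi hix _
              · exact hrS' hi hiy _
            rw [this, hbp, hp₁, hp₂]
            simp [hix, hiy, ht0]
    refine lt_of_lt_of_le (ballVolume_pos_of_isOpen hO (p := p₁ + t • p₂) fun a ha => ?_)
      (measure_mono hOsub)
    refine ⟨fun i => ?_, fun i => ?_⟩
    · rw [inner_smul_right, mul_left_comm]
      exact mul_pos ha (hmem.1 i)
    · rw [map_smul, inner_smul_right, mul_left_comm]
      exact mul_pos ha (hmem.2 i)
  have h1 := measure_inter_add_sdiff (μ := ballVolume E) (A ∩ G) hmrG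
  have h2 := measure_inter_add_sdiff (μ := ballVolume E) (A ∩ r ⁻¹' G) hmG
  rw [show A ∩ r ⁻¹' G ∩ G = A ∩ G ∩ r ⁻¹' G by ext p; simp only [Set.mem_inter_iff]; tauto] at h2
  rw [← h1, ← h2]
  refine ENNReal.add_lt_add_left (measure_ne_top _ _) ?_
  refine lt_of_lt_of_le ?_ (measure_mono hsub)
  rw [measure_union hdisj (((hmA.inter hmrG).diff hmG).diff hmrA), ballVolume_preimage r]
  exact ENNReal.lt_add_right (measure_ne_top _ _) hpos.ne'

end Orthants

/-! ### Descent classes as volumes of orthants -/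

section DescentVolume

open MeasureTheory
open scoped RealInnerProductSpace

namespace CoxeterSystem.EuclideanRealization

variable {B W : Type*} [Group W] {M : CoxeterMatrix B} {cs : CoxeterSystem M W}
  {E : Type*} [NormedAddCommGroup E] [InnerProductSpace ℝ E] (R : cs.EuclideanRealization E)

open Classical in
/-- The simple roots, those with index in `J` being negated. -/
noncomputable def signedRoot (J : Set B) (i : B) : E :=
  if i ∈ J then -R.root i else R.root i

/-- The open orthant of the points where exactly the simple roots with index in `J` are negative. -/
def orthant (J : Set B) : Set E := {p | ∀ i, 0 < ⟪R.signedRoot J i, p⟫}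

theorem signedRoot_of_mem {J : Set B} {i : B} (h : i ∈ J) : R.signedRoot J i = -R.root i :=
  if_pos h

theorem signedRoot_of_notMem {J : Set B} {i : B} (h : i ∉ J) : R.signedRoot J i = R.root i :=
  if_neg h

theorem signedRoot_congr {J J' : Set B} {i : B} (h : i ∈ J ↔ i ∈ J') :
    R.signedRoot J i = R.signedRoot J' i := by
  by_cases hi : i ∈ J
  · rw [R.signedRoot_of_mem hi, R.signedRoot_of_mem (h.mp hi)]
  · rw [R.signedRoot_of_notMem hi, R.signedRoot_of_notMem (fun h' => hi (h.mpr h'))]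

theorem signedRoot_eq_smul (J : Set B) (i : B) :
    ∃ u : ℝˣ, R.signedRoot J i = u • R.root i := by
  by_cases h : i ∈ J
  · exact ⟨-1, by simp [R.signedRoot_of_mem h]⟩
  · exact ⟨1, by simp [R.signedRoot_of_notMem h]⟩

theorem linearIndependent_signedRoot (J : Set B) : LinearIndependent ℝ (R.signedRoot J) := by
  choose u hu using R.signedRoot_eq_smul J
  rw [show R.signedRoot J = u • R.root from funext hu]
  exact R.linearIndependent_root.units_smul u

theorem isOpen_orthant [Finite B] (J : Set B) : IsOpen (R.orthant J) := by
  rw [orthant, Set.ofPred_forall]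
  exact isOpen_iInter_of_finite fun i => isOpen_lt (by fun_prop) (by fun_prop)

theorem root_ne_zero (i : B) : R.root i ≠ 0 := by
  rw [← norm_ne_zero_iff, R.norm_root]; exact one_ne_zero

theorem toHom_mul_apply (w w' : W) (p : E) : R.toHom (w * w') p = R.toHom w (R.toHom w' p) := by
  rw [map_mul, LinearIsometryEquiv.coe_mul, Function.comp_apply]

theorem toHom_simple_root (i : B) : R.toHom (cs.simple i) (R.root i) = -R.root i := by
  rw [R.toHom_simple, real_inner_self_eq_norm_sq, R.norm_root]
  module

theorem inner_neg_of_isRightDescent {w : W} {i : B} {p : E} (h : cs.IsRightDescent w i)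
    (hp : ∀ j, 0 < ⟪R.root j, p⟫) : ⟪R.toHom w (R.root i), p⟫ < 0 := by
  have h1 := R.inner_pos (w * cs.simple i) i p (cs.isRightDescent_iff_not_isRightDescent_mul.mp h) hp
  rw [R.toHom_mul_apply, R.toHom_simple_root, map_neg, inner_neg_left] at h1
  linarith

theorem inner_toHom (w : W) (p q : E) : ⟪p, R.toHom w q⟫ = ⟪R.toHom w⁻¹ p, q⟫ := by
  rw [← (R.toHom w⁻¹).inner_map_map, ← R.toHom_mul_apply, inv_mul_cancel, map_one,
    LinearIsometryEquiv.coe_one, id_eq]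

theorem toHom_mem_orthant_iff {w : W} {J : Set B} {p : E} (hp : ∀ j, 0 < ⟪R.root j, p⟫) :
    R.toHom w p ∈ R.orthant J ↔ w⁻¹ ∈ cs.descentClass J := by
  refine forall_congr' fun i => ?_
  change _ ↔ (cs.IsRightDescent w⁻¹ i ↔ i ∈ J)
  rw [R.inner_toHom]
  generalize w⁻¹ = u
  by_cases hd : cs.IsRightDescent u i
  · have := R.inner_neg_of_isRightDescent hd hp
    by_cases hi : i ∈ J
    · simp [R.signedRoot_of_mem hi, hd, hi, this]
    · simp [R.signedRoot_of_notMem hi, hd, hi, this.le]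
  · have := R.inner_pos _ i p hd hp
    by_cases hi : i ∈ J
    · simp [R.signedRoot_of_mem hi, hd, hi, this.le]
    · simp [R.signedRoot_of_notMem hi, hd, hi, this]

/-- A point outside of the reflecting hyperplanes has a translate in the fundamental chamber. -/
theorem exists_toHom_mem_chamber [Finite W] [FiniteDimensional ℝ E] {p : E}
    (hp : ∀ w i, ⟪R.toHom w (R.root i), p⟫ ≠ 0) : ∃ w, ∀ i, 0 < ⟪R.root i, R.toHom w p⟫ := by
  obtain ⟨d, hd⟩ := R.linearIndependent_root.exists_inner_eq fun _ => 1
  -- The translate that is highest with respect to a point `d` of the chamber.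
  obtain ⟨w, hw⟩ := Finite.exists_max fun w => ⟪d, R.toHom w p⟫
  refine ⟨w, fun i => lt_of_le_of_ne ?_ ?_⟩
  · have h := hw (cs.simple i * w)
    rw [R.toHom_mul_apply, R.toHom_simple, inner_sub_right, inner_smul_right,
      real_inner_comm (R.root i) d, hd] at h
    linarith
  · rw [R.inner_toHom]
    exact (hp _ i).symm

variable [FiniteDimensional ℝ E] [MeasurableSpace E] [BorelSpace E]

/-- A descent class makes up the same proportion of the group as the matching orthant does of the
ball. -/
theorem card_mul_ballVolume_orthant [Finite W] [Finite B] (J : Set B) :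
    Nat.card W * ballVolume E (R.orthant J) =
      (cs.descentClass J).ncard * ballVolume E Set.univ := by
  classical
  have := Fintype.ofFinite W
  have hmeas (w : W) : MeasurableSet (R.toHom w ⁻¹' R.orthant J) :=
    (R.toHom w).continuous.measurable (R.isOpen_orthant J).measurableSet
  have hgen : ∀ᵐ p ∂ballVolume E, ∀ w i, ⟪R.toHom w (R.root i), p⟫ ≠ 0 := by
    rw [ae_all_iff]
    intro w
    rw [ae_all_iff]
    intro i
    rw [ae_iff]
    simpa using ballVolume_setOf_inner_eq_zero (v := R.toHom w (R.root i))
      (by simpa using R.root_ne_zero i)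
  -- A generic orbit has as many points in the orthant as the descent class has elements.
  have hcount : ∀ᵐ p ∂ballVolume E,
      ∑ w : W, (R.toHom w ⁻¹' R.orthant J).indicator (1 : E → ENNReal) p =
        (cs.descentClass J).ncard := by
    filter_upwards [hgen] with p hp
    obtain ⟨g, hg⟩ := R.exists_toHom_mem_chamber hp
    have hiff (w : W) : p ∈ R.toHom w ⁻¹' R.orthant J ↔ g * w⁻¹ ∈ cs.descentClass J := by
      have h := R.toHom_mem_orthant_iff (w := w * g⁻¹) (J := J) hg
      rw [← R.toHom_mul_apply, inv_mul_cancel_right, mul_inv_rev,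
        inv_inv] at h
      exact h
    simp only [Set.indicator_apply, hiff, Pi.one_apply]
    rw [Finset.sum_boole, Set.ncard_eq_toFinset_card']
    congr 1
    refine Finset.card_bij (fun w _ => g * w⁻¹) (by simp) (by simp) fun w hw => ?_
    exact ⟨w⁻¹ * g, by simpa using hw, by simp⟩
  calc (Nat.card W : ENNReal) * ballVolume E (R.orthant J)
      = ∑ w : W, ballVolume E (R.toHom w ⁻¹' R.orthant J) := by
        simp [ballVolume_preimage, Nat.card_eq_fintype_card]
    _ = ∫⁻ p, ∑ w : W, (R.toHom w ⁻¹' R.orthant J).indicator (1 : E → ENNReal) p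
          ∂ballVolume E := by
        rw [lintegral_finsetSum _ fun w _ => measurable_one.indicator (hmeas w)]
        exact Finset.sum_congr rfl fun w _ => (lintegral_indicator_one (hmeas w)).symm
    _ = (cs.descentClass J).ncard * ballVolume E Set.univ := by
        rw [lintegral_congr_ae hcount, lintegral_const]

theorem ncard_descentClass_lt_iff [Finite W] [Finite B] (J J' : Set B) :
    (cs.descentClass J).ncard < (cs.descentClass J').ncard ↔
      ballVolume E (R.orthant J) < ballVolume E (R.orthant J') := by
  have h0 : (Nat.card W : ENNReal) ≠ 0 := by exact_mod_cast Nat.card_pos.ne'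
  have ht : (Nat.card W : ENNReal) ≠ ⊤ := by simp
  rw [← ENNReal.mul_lt_mul_iff_right h0 ht, R.card_mul_ballVolume_orthant,
    R.card_mul_ballVolume_orthant,
    ENNReal.mul_lt_mul_iff_left (ballVolume_univ_pos).ne' (measure_ne_top _ _), Nat.cast_lt]

end CoxeterSystem.EuclideanRealization

end DescentVolume

/-! ### The Coxeter graph of a finite Coxeter group is a forest -/

section CoxeterForest

open Real
open scoped RealInnerProductSpace

namespace CoxeterSystem

variable {B W : Type*} [Group W] {M : CoxeterMatrix B}

namespace EuclideanRealization

variable {cs : CoxeterSystem M W} {E : Type*} [NormedAddCommGroup E] [InnerProductSpace ℝ E]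
  (R : cs.EuclideanRealization E)

theorem inner_root_eq_zero {i j : B} (hij : i ≠ j) (h : ¬ M.coxeterGraph.Adj i j) :
    ⟪R.root i, R.root j⟫ = 0 := by
  have hM : M i j = 2 := by
    by_contra hne
    exact h ⟨hij, hne⟩
  rw [R.inner_root i j hij, hM]
  simp

theorem inner_root_le {i j : B} (h : M.coxeterGraph.Adj i j) :
    ⟪R.root i, R.root j⟫ ≤ -1 / 2 := by
  rw [R.inner_root i j h.1]
  suffices 1 / 2 ≤ cos (π / M i j) by linarith
  by_cases h0 : M i j = 0
  · rw [h0, Nat.cast_zero, div_zero, cos_zero]; norm_num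
  · have h3 : (3 : ℝ) ≤ M i j := by
      have := M.off_diagonal i j h.1
      have := h.2
      exact_mod_cast (by omega : 3 ≤ M i j)
    rw [← cos_pi_div_three]
    apply cos_le_cos_of_nonneg_of_le_pi (by positivity) (by linarith [pi_pos])
    exact div_le_div_of_nonneg_left pi_pos.le (by norm_num) h3

end EuclideanRealization

/-- Each finite set of vertices has one with at most one neighbor in the set, since otherwise the sum
of the corresponding simple roots would vanish. -/
theorem exists_card_neighbors_lt_two [Finite W] (cs : CoxeterSystem M W) {T : Finset B}
    (hT : T.Nonempty) [DecidableRel M.coxeterGraph.Adj] :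
    ∃ i ∈ T, (T.filter (M.coxeterGraph.Adj i)).card < 2 := by
  classical
  obtain ⟨n, ⟨R⟩⟩ := cs.exists_euclideanRealization
  by_contra! hcon
  have hle : ⟪∑ i ∈ T, R.root i, ∑ j ∈ T, R.root j⟫ ≤ 0 := by
    rw [sum_inner]
    refine Finset.sum_nonpos fun i hi => ?_
    rw [inner_sum]
    calc ∑ j ∈ T, ⟪R.root i, R.root j⟫
        ≤ ∑ j ∈ T, ((if i = j then 1 else 0) +
            (if M.coxeterGraph.Adj i j then -1 / 2 else 0) : ℝ) := by
          refine Finset.sum_le_sum fun j _ => ?_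
          by_cases hij : i = j
          · subst hij
            simp [R.norm_root]
          · by_cases h : M.coxeterGraph.Adj i j
            · simpa [hij, h] using R.inner_root_le h
            · simp [hij, h, R.inner_root_eq_zero hij h]
      _ = 1 + (T.filter (M.coxeterGraph.Adj i)).card * (-1 / 2) := by
          rw [Finset.sum_add_distrib, Finset.sum_ite_eq, if_pos hi, ← Finset.sum_filter,
            Finset.sum_const, nsmul_eq_mul]
      _ ≤ 0 := by
          have : (2 : ℝ) ≤ (T.filter (M.coxeterGraph.Adj i)).card := by exact_mod_cast hcon i hi
          linarith
  have h0 : ∑ i ∈ T, R.root i = 0 := by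
    rwa [real_inner_self_nonpos] at hle
  obtain ⟨i, hi⟩ := hT
  have := linearIndependent_iff'.mp R.linearIndependent_root T (fun _ => 1) (by simpa using h0) i hi
  exact one_ne_zero this

theorem isAcyclic_coxeterGraph [Finite W] (cs : CoxeterSystem M W) :
    M.coxeterGraph.IsAcyclic := by
  classical
  intro u p hp
  obtain ⟨i, hi, hlt⟩ := cs.exists_card_neighbors_lt_two (T := p.support.toFinset)
    ⟨u, by simp⟩
  rw [List.mem_toFinset] at hi
  have h2 := hp.ncard_neighborSet_toSubgraph_eq_two hi
  have hsub : p.toSubgraph.neighborSet i ⊆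
      (p.support.toFinset.filter (M.coxeterGraph.Adj i) : Finset B) := by
    intro j hj
    rw [Finset.mem_coe, Finset.mem_filter, List.mem_toFinset]
    exact ⟨p.mem_verts_toSubgraph.mp (p.toSubgraph.edge_vert hj.symm), p.toSubgraph.adj_sub hj⟩
  have := Set.ncard_le_ncard hsub (Finset.finite_toSet _)
  rw [h2, Set.ncard_coe_finset] at this
  omega

end CoxeterSystem

end CoxeterForest

/-! ### Comparison of descent classes -/

section DescentClasses

open scoped RealInnerProductSpace

namespace SimpleGraph

variable {V : Type*} {G : SimpleGraph V}

/-- Removing a bridge from a connected graph leaves two components. -/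
theorem Connected.isCompl_supp_of_isBridge (hG : G.Connected) {x y : V}
    (h : G.IsBridge s(x, y)) :
    IsCompl ((G.deleteEdges {s(x, y)}).connectedComponentMk x).supp
      ((G.deleteEdges {s(x, y)}).connectedComponentMk y).supp := by
  rw [isBridge_iff] at h
  constructor
  · rw [Set.disjoint_left]
    intro z hz hz'
    rw [ConnectedComponent.mem_supp_iff, ConnectedComponent.eq] at hz hz'
    exact h (hz.symm.trans hz')
  · rw [codisjoint_iff_le_sup]
    intro z _
    obtain ⟨p⟩ := hG.preconnected z x
    change z ∈ _ ∪ _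
    simp only [Set.mem_union, ConnectedComponent.mem_supp_iff, ConnectedComponent.eq]
    induction p with
    | nil => exact Or.inl (Reachable.refl _)
    | @cons a b c hab p ih =>
      by_cases he : s(a, b) = s(c, y)
      · rcases Sym2.eq_iff.mp he with ⟨rfl, -⟩ | ⟨rfl, -⟩
        · exact Or.inl (Reachable.refl _)
        · exact Or.inr (Reachable.refl _)
      · have hadj : (G.deleteEdges {s(c, y)}).Adj a b := by
          rw [deleteEdges_adj]
          exact ⟨hab, by simpa using he⟩
        exact (ih h trivial).imp hadj.reachable.trans hadj.reachable.trans

/-- In a connected graph, there is at most one partition into two independent sets. -/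
theorem Connected.eq_or_eq_compl_of_isIndepSet (hG : G.Connected) {J J' : Set V}
    (hJ : G.IsIndepSet J) (hJc : G.IsIndepSet Jᶜ) (hJ' : G.IsIndepSet J')
    (hJc' : G.IsIndepSet J'ᶜ) : J' = J ∨ J' = Jᶜ := by
  have hflip {K : Set V} (hK : G.IsIndepSet K) (hKc : G.IsIndepSet Kᶜ) {a b : V}
      (hab : G.Adj a b) : a ∈ K ↔ b ∉ K := by
    constructor
    · exact fun ha hb => hK ha hb hab.ne hab
    · intro hb
      by_contra ha
      exact hKc ha hb hab.ne hab
  have hwalk {a b : V} (p : G.Walk a b) : (a ∈ J ↔ a ∈ J') ↔ (b ∈ J ↔ b ∈ J') := by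
    induction p with
    | nil => rfl
    | cons hab p ih =>
      rw [← ih, hflip hJ hJc hab, hflip hJ' hJc' hab, not_iff_not]
  obtain ⟨x⟩ := hG.nonempty
  by_cases hx : x ∈ J ↔ x ∈ J'
  · left
    ext z
    obtain ⟨p⟩ := hG.preconnected x z
    exact ((hwalk p).mp hx).symm
  · right
    ext z
    obtain ⟨p⟩ := hG.preconnected x z
    have := (not_congr (hwalk p)).mp hx
    rw [Set.mem_compl_iff]
    tauto

end SimpleGraph

namespace CoxeterSystem

variable {B W : Type*} [Group W] {M : CoxeterMatrix B} (cs : CoxeterSystem M W)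

namespace EuclideanRealization

variable {cs} {E : Type*} [NormedAddCommGroup E] [InnerProductSpace ℝ E]
  (R : cs.EuclideanRealization E)

theorem signedRoot_compl (J : Set B) (i : B) : R.signedRoot Jᶜ i = -R.signedRoot J i := by
  by_cases h : i ∈ J
  · rw [R.signedRoot_of_mem h, R.signedRoot_of_notMem (by simpa using h), neg_neg]
  · rw [R.signedRoot_of_notMem h, R.signedRoot_of_mem (by simpa using h)]

variable [FiniteDimensional ℝ E] [MeasurableSpace E] [BorelSpace E]

theorem ballVolume_orthant_compl (J : Set B) :
    ballVolume E (R.orthant Jᶜ) = ballVolume E (R.orthant J) := by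
  rw [← ballVolume_preimage (LinearIsometryEquiv.neg ℝ)]
  congr 1
  ext p
  simp [orthant, R.signedRoot_compl]

theorem ballVolume_orthant_lt [Finite B] {J S₁ S₂ : Set B} (hS : IsCompl S₁ S₂) {x y : B}
    (hx : x ∈ S₁) (hy : y ∈ S₂) (hxy : M.coxeterGraph.Adj x y) (hJ : x ∈ J ↔ y ∈ J)
    (hcut : ∀ i ∈ S₁, ∀ j ∈ S₂, M.coxeterGraph.Adj i j → i = x ∧ j = y) :
    ballVolume E (R.orthant J) < ballVolume E (R.orthant ((S₁ ∩ J) ∪ (S₂ ∩ Jᶜ))) := by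
  obtain rfl : S₁ᶜ = S₂ := hS.compl_eq
  have hinner (i j : B) (hij : i ∈ J ↔ j ∈ J) :
      ⟪R.signedRoot J i, R.signedRoot J j⟫ = ⟪R.root i, R.root j⟫ := by
    by_cases h : i ∈ J
    · rw [R.signedRoot_of_mem h, R.signedRoot_of_mem (hij.mp h), inner_neg_neg]
    · rw [R.signedRoot_of_notMem h, R.signedRoot_of_notMem (fun h' => h (hij.mpr h'))]
  have key := _root_.ballVolume_orthant_lt (R.linearIndependent_signedRoot J) S₁ hx hy
    (by rw [hinner x y hJ]; linarith [R.inner_root_le hxy])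
    (fun i hi j hj hne => by
      have h0 : ⟪R.root i, R.root j⟫ = 0 :=
        R.inner_root_eq_zero (fun h => hj (h ▸ hi)) fun h => hne (hcut i hi j hj h)
      obtain ⟨u, hu⟩ := R.signedRoot_eq_smul J i
      obtain ⟨u', hu'⟩ := R.signedRoot_eq_smul J j
      rw [hu, hu', Units.smul_def, Units.smul_def, inner_smul_left, inner_smul_right, h0, mul_zero,
        mul_zero])
  have h1 : R.orthant J = {p | (∀ i ∈ S₁, 0 < ⟪R.signedRoot J i, p⟫) ∧
      ∀ i ∉ S₁, 0 < ⟪R.signedRoot J i, p⟫} := by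
    ext p
    exact ⟨fun h => ⟨fun i _ => h i, fun i _ => h i⟩,
      fun h i => (em (i ∈ S₁)).elim (h.1 i) (h.2 i)⟩
  have h2 : R.orthant ((S₁ ∩ J) ∪ (S₁ᶜ ∩ Jᶜ)) = {p | (∀ i ∈ S₁, 0 < ⟪R.signedRoot J i, p⟫) ∧
      ∀ i ∉ S₁, ⟪R.signedRoot J i, p⟫ < 0} := by
    have e1 {i : B} (hi : i ∈ S₁) :
        R.signedRoot ((S₁ ∩ J) ∪ (S₁ᶜ ∩ Jᶜ)) i = R.signedRoot J i :=
      R.signedRoot_congr (by simp [hi])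
    have e2 {i : B} (hi : i ∉ S₁) :
        R.signedRoot ((S₁ ∩ J) ∪ (S₁ᶜ ∩ Jᶜ)) i = -R.signedRoot J i := by
      rw [← R.signedRoot_compl]
      exact R.signedRoot_congr (by simp [hi])
    ext p
    constructor
    · intro h
      refine ⟨fun i hi => e1 hi ▸ h i, fun i hi => ?_⟩
      have := h i
      rw [e2 hi, inner_neg_left] at this
      linarith
    · intro h i
      by_cases hi : i ∈ S₁
      · exact (e1 hi).symm ▸ h.1 i hi
      · rw [e2 hi, inner_neg_left]
        linarith [h.2 i hi]
  rw [h1, h2]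
  exact key

end EuclideanRealization

theorem ncard_descentClass_compl [Finite W] (J : Set B) :
    (cs.descentClass Jᶜ).ncard = (cs.descentClass J).ncard := by
  have : Finite B := Finite.of_injective _ cs.simple_injective
  obtain ⟨n, ⟨R⟩⟩ := cs.exists_euclideanRealization
  apply le_antisymm <;>
    · rw [← not_lt, R.ncard_descentClass_lt_iff, R.ballVolume_orthant_compl]
      exact lt_irrefl _

/-- Complementing `J` on one side of an edge with both ends inside or both ends outside of `J`
enlarges the descent class. -/
theorem isCompl_and_ncard_descentClass_lt [Finite W] (hirr : M.coxeterGraph.Connected) (J : Set B)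
    {x y : B} (hxy : M.coxeterGraph.Adj x y) (hJ : x ∈ J ↔ y ∈ J) {S₁ S₂ : Set B}
    (hS₁ : S₁ = ((M.coxeterGraph.deleteEdges {s(x, y)}).connectedComponentMk x).supp)
    (hS₂ : S₂ = ((M.coxeterGraph.deleteEdges {s(x, y)}).connectedComponentMk y).supp) :
    IsCompl S₁ S₂ ∧
      (cs.descentClass J).ncard < (cs.descentClass ((S₁ ∩ J) ∪ (S₂ ∩ Jᶜ))).ncard := by
  have : Finite B := Finite.of_injective _ cs.simple_injective
  obtain ⟨n, ⟨R⟩⟩ := cs.exists_euclideanRealization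
  have hbridge : M.coxeterGraph.IsBridge s(x, y) :=
    SimpleGraph.isAcyclic_iff_forall_adj_isBridge.mp cs.isAcyclic_coxeterGraph hxy
  have hcompl : IsCompl S₁ S₂ := by
    rw [hS₁, hS₂]
    exact hirr.isCompl_supp_of_isBridge hbridge
  have hx : x ∈ S₁ := by simp [hS₁]
  have hy : y ∈ S₂ := by simp [hS₂]
  refine ⟨hcompl, ?_⟩
  rw [R.ncard_descentClass_lt_iff]
  refine R.ballVolume_orthant_lt hcompl hx hy hxy hJ fun i hi j hj hij => ?_
  -- An edge other than `s(x, y)` would join the two components.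
  by_cases he : s(i, j) = s(x, y)
  · rcases Sym2.eq_iff.mp he with h | ⟨rfl, rfl⟩
    · exact h
    · exact absurd hj (Set.disjoint_left.mp hcompl.disjoint hx)
  · have hadj : (M.coxeterGraph.deleteEdges {s(x, y)}).Adj i j := by
      rw [SimpleGraph.deleteEdges_adj]
      exact ⟨hij, by simpa using he⟩
    have hjS : j ∈ S₁ := by
      rw [hS₁, SimpleGraph.ConnectedComponent.mem_supp_iff] at hi ⊢
      rw [← hi, SimpleGraph.ConnectedComponent.eq]
      exact hadj.reachable.symm
    exact absurd hj (Set.disjoint_left.mp hcompl.disjoint hjS)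

theorem ncard_descentClass_le_springerNumber [Finite W] (J : Set B) :
    (cs.descentClass J).ncard ≤ cs.springerNumber :=
  le_ciSup (f := fun J : Set B => (cs.descentClass J).ncard)
    ⟨Nat.card W, by rintro _ ⟨J, rfl⟩; exact Set.ncard_le_card _⟩ J

theorem exists_springerNumber_eq [Finite W] :
    ∃ J : Set B, cs.springerNumber = (cs.descentClass J).ncard := by
  have : Finite B := Finite.of_injective _ cs.simple_injective
  obtain ⟨J, hJ⟩ := exists_eq_ciSup_of_finite (f := fun J : Set B => (cs.descentClass J).ncard)
  exact ⟨J, hJ.symm⟩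

theorem isIndepSet_of_springerNumber_eq [Finite W] (hirr : M.coxeterGraph.Connected) {J : Set B}
    (h : cs.springerNumber = (cs.descentClass J).ncard) :
    M.coxeterGraph.IsIndepSet J ∧ M.coxeterGraph.IsIndepSet Jᶜ := by
  have key {x y : B} (hxy : M.coxeterGraph.Adj x y) (hJ : x ∈ J ↔ y ∈ J) : False := by
    have h1 := (cs.isCompl_and_ncard_descentClass_lt hirr J hxy hJ rfl rfl).2
    rw [← h] at h1
    exact absurd (cs.ncard_descentClass_le_springerNumber _) (not_le.mpr h1)
  exact ⟨fun x hx y hy _ hxy => key hxy (iff_of_true hx hy),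
    fun x hx y hy _ hxy => key hxy (iff_of_false hx hy)⟩

theorem springerNumber_eq_iff [Finite W] (hirr : M.coxeterGraph.Connected) (J : Set B) :
    cs.springerNumber = (cs.descentClass J).ncard ↔
      M.coxeterGraph.IsIndepSet J ∧ M.coxeterGraph.IsIndepSet Jᶜ := by
  refine ⟨cs.isIndepSet_of_springerNumber_eq hirr, fun ⟨hJ, hJc⟩ => ?_⟩
  obtain ⟨J₀, hJ₀⟩ := cs.exists_springerNumber_eq
  obtain ⟨h, hc⟩ := cs.isIndepSet_of_springerNumber_eq hirr hJ₀
  rcases hirr.eq_or_eq_compl_of_isIndepSet h hc hJ hJc with rfl | rfl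
  · exact hJ₀
  · rw [cs.ncard_descentClass_compl, hJ₀]

end CoxeterSystem

end DescentClasses

theorem mainTheorem11 {B W : Type*} [Group W] [Finite W] {M : CoxeterMatrix B}
    (cs : CoxeterSystem M W) (hirr : M.coxeterGraph.Connected) :
    (∀ (J : Set B) (x y : B), M.coxeterGraph.Adj x y →
      ((x ∈ J ∧ y ∈ J) ∨ (x ∉ J ∧ y ∉ J)) →
      ∀ S₁ S₂ : Set B,
        S₁ = ((M.coxeterGraph.deleteEdges {s(x, y)}).connectedComponentMk x).supp →
        S₂ = ((M.coxeterGraph.deleteEdges {s(x, y)}).connectedComponentMk y).supp →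
        IsCompl S₁ S₂ ∧
          (cs.descentClass J).ncard < (cs.descentClass ((S₁ ∩ J) ∪ (S₂ ∩ Jᶜ))).ncard) ∧
    (∀ J : Set B, cs.springerNumber = (cs.descentClass J).ncard ↔
      M.coxeterGraph.IsIndepSet J ∧ M.coxeterGraph.IsIndepSet Jᶜ) ∧
    (∃ J₀ : Set B, J₀ ≠ J₀ᶜ ∧
      {J : Set B | cs.springerNumber = (cs.descentClass J).ncard} = {J₀, J₀ᶜ}) := by
  refine ⟨fun J x y hxy hJ S₁ S₂ h₁ h₂ =>
    cs.isCompl_and_ncard_descentClass_lt hirr J hxy (by tauto) h₁ h₂,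
    cs.springerNumber_eq_iff hirr, ?_⟩
  obtain ⟨J₀, hJ₀⟩ := cs.exists_springerNumber_eq
  obtain ⟨h, hc⟩ := cs.isIndepSet_of_springerNumber_eq hirr hJ₀
  have := hirr.nonempty
  refine ⟨J₀, ne_compl_self, Set.ext fun J => ⟨fun hJ => ?_, ?_⟩⟩
  · obtain ⟨h', hc'⟩ := cs.isIndepSet_of_springerNumber_eq hirr hJ
    exact hirr.eq_or_eq_compl_of_isIndepSet h hc h' hc'
  · rintro (rfl | rfl)
    · exact hJ₀
    · rw [Set.mem_ofPred_eq, cs.ncard_descentClass_compl, hJ₀]
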